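/- Let $a<b$ be coprime positive integers. An $a,b$-Dyck path is a lattice path in $\mathbb{Z}^2$ consisting of unit north and east steps, from $(0,0)$ to $(b,a)$, that stays weakly above the line $y=\frac{a}{b}x$. A valley of such a path $D$ is a lattice point of $D$ immediately preceded by an east step and immediately followed by a north step; the laser fired from a valley $P$ is the line segment of slope $\frac{a}{b}$ that starts at $P$, goes northeast, and ends at the first point after $P$ at which it meets $D$. For $1\le i\le b-1$, place the label $i$ slightly below the east end of the $i$-th east step of $D$. Let $\pi(D)$ be the set partition of $[b-1]=\{1,\dots,b-1\}$ in which $i\sim j$ if and only if the labels $i$ and $j$ are not separated by a laser fired from a valley of $D$, where a laser separates two labels if exactly one of them lies in the region enclosed between the laser and $D$. Let $$\mathsf{NC}(a,b)=\{\pi(D) : D \text{ an } a,b\text{-Dyck path}\}.$$ Let $\mathtt{rot}$ be the permutation $1\mapsto 2\mapsto\cdots\mapsto b-1\mapsto 1$ of $[b-1]$ and let $\mathtt{rfn}$ be the permutation $i\mapsto b-i$ of $[b-1]$. Permutations of $[b-1]$ act on set partitions of $[b-1]$ by applying them to the elements of every block. Then $\mathsf{NC}(a,b)$ is closed under the action of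 the dihedral group $\langle\mathtt{rot},\mathtt{rfn}\rangle$: for every $g\in\langle\mathtt{rot},\mathtt{rfn}\rangle$ and every $\pi\in\mathsf{NC}(a,b)$, we have $g\cdot\pi\in\mathsf{NC}(a,b)$. -/

import Mathlib

namespace RationalNC

/-- A unit step of a lattice path: north or east. -/
inductive Step : Type
  | N : Step
  | E : Step
  deriving DecidableEq

/-- The `x`-coordinate of the lattice point reached after the first `k` steps of the path `D`
started at `(0, 0)`. -/
def xAt (D : List Step) (k : ℕ) : ℕ := (D.take k).count Step.E

/-- The `y`-coordinate of the lattice point reached after the first `k` steps of the path `D`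
started at `(0, 0)`. -/
def yAt (D : List Step) (k : ℕ) : ℕ := (D.take k).count Step.N

/-- `D` is an `a,b`-Dyck path: a lattice path of north and east steps from `(0, 0)` to `(b, a)`
that stays weakly above the line `y = (a / b) x`. -/
structure IsDyckPath (a b : ℕ) (D : List Step) : Prop where
  count_north : D.count Step.N = a
  count_east : D.count Step.E = b
  above : ∀ k ≤ D.length, a * xAt D k ≤ b * yAt D k

/-- The lattice point reached after `k` steps, as a point of the real plane. -/
noncomputable def latticePoint (D : List Step) (k : ℕ) : ℝ × ℝ := ((xAt D k : ℝ), (yAt D k : ℝ))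

/-- The subset of the plane traced out by the path: the union of its unit steps. -/
def trace (D : List Step) : Set (ℝ × ℝ) :=
  {p | ∃ k < D.length, p ∈ segment ℝ (latticePoint D k) (latticePoint D (k + 1))}

/-- The lattice point after `k` steps is a valley: it is immediately preceded by an east step and
immediately followed by a north step. (Step number `k` of the path, counted from `0`, is `D[k]`.) -/
def IsValley (D : List Step) (k : ℕ) : Prop :=
  1 ≤ k ∧ D[k - 1]? = some Step.E ∧ D[k]? = some Step.N

/-- The point at horizontal distance `t` on the ray of slope `a / b` fired northeast from the
lattice point after `k` steps. -/
noncomputable def rayPoint (a b : ℕ) (D : List Step) (k : ℕ) (t : ℝ) : ℝ × ℝ :=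
  ((xAt D k : ℝ) + t, (yAt D k : ℝ) + (a : ℝ) / (b : ℝ) * t)

/-- The laser fired from the lattice point after `k` steps has horizontal extent `t`: the ray of
slope `a / b` meets the path at distance `t`, and not before (apart from its starting point). -/
def LaserExtent (a b : ℕ) (D : List Step) (k : ℕ) (t : ℝ) : Prop :=
  0 < t ∧ rayPoint a b D k t ∈ trace D ∧ ∀ s, 0 < s → s < t → rayPoint a b D k s ∉ trace D

/-- `IsLabel D i h`: the east end of the `i`-th east step of `D` (counted from `1`) is the lattice
point `(i, h)`. This is the lattice point that carries the label `i`. -/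
def IsLabel (D : List Step) (i h : ℕ) : Prop :=
  ∃ m, D[m]? = some Step.E ∧ xAt D (m + 1) = i ∧ yAt D (m + 1) = h

/-- The laser fired from the lattice point after `k` steps cuts off the label `i`, that is, the
label lies in the region enclosed between the laser and the path, vertically above a point of the
laser. Since labels are placed slightly below their lattice points, a label whose lattice point is
on the laser is not above it: hence the strict inequality. -/
def CutsOff (a b : ℕ) (D : List Step) (k i : ℕ) : Prop :=
  ∃ t h, LaserExtent a b D k t ∧ IsLabel D i h ∧
    (xAt D k : ℝ) ≤ (i : ℝ) ∧ (i : ℝ) ≤ (xAt D k : ℝ) + t ∧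
    (yAt D k : ℝ) + (a : ℝ) / (b : ℝ) * ((i : ℝ) - (xAt D k : ℝ)) < (h : ℝ)

/-- The set partition `π(D)` of `[b - 1]`, as an equivalence relation: two labels are equivalent
if and only if no laser fired from a valley of `D` separates them (a laser separates two labels if
it cuts off exactly one of them). The element `i : Fin (b - 1)` stands for the label `i + 1`. -/
def visibility (a b : ℕ) (D : List Step) : Setoid (Fin (b - 1)) where
  r i j := ∀ k, IsValley D k →
    (CutsOff a b D k ((i : ℕ) + 1) ↔ CutsOff a b D k ((j : ℕ) + 1))
  iseqv :=
    { refl := fun _ _ _ => Iff.rfl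
      symm := fun h k hk => (h k hk).symm
      trans := fun h₁ h₂ k hk => (h₁ k hk).trans (h₂ k hk) }

/-- The set `NC(a, b)` of `a,b`-noncrossing partitions of `[b - 1]`. -/
def NC (a b : ℕ) : Set (Setoid (Fin (b - 1))) :=
  {π | ∃ D, IsDyckPath a b D ∧ π = visibility a b D}

/-- The rotation `1 ↦ 2 ↦ ⋯ ↦ n ↦ 1` of `[n]`. -/
def rot (n : ℕ) : Equiv.Perm (Fin n) := finRotate n

/-- The reflection `i ↦ n + 1 - i` of `[n]`. -/
def rfn (n : ℕ) : Equiv.Perm (Fin n) := Fin.revPerm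

/-- The group of permutations of `[n]` generated by rotation and reflection. -/
def dihedral (n : ℕ) : Subgroup (Equiv.Perm (Fin n)) := Subgroup.closure {rot n, rfn n}

/-- The action of a permutation on set partitions: the blocks of `permute g π` are the images under
`g` of the blocks of `π`, so `i` and `j` are equivalent iff `g⁻¹ i` and `g⁻¹ j` are so for `π`. -/
def permute {n : ℕ} (g : Equiv.Perm (Fin n)) (π : Setoid (Fin n)) : Setoid (Fin n) :=
  Setoid.comap (fun i => g⁻¹ i) π

end RationalNC

/-!
The proof characterizes `NC a b` by a condition that is visibly invariant under rotation and
reflection, with no reference to paths.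

*From paths to rank sequences.* Give the point `(x, y)` the rank `b y - a x`, and let `r i` be the
rank of the point carrying the label `i`. Rank is constant along rays of slope `a / b`, so the laser
fired from the valley with label `p` cuts off exactly the labels of the interval `(p, q]`, where `q`
is largest such that `r > r p` on `(p, q]` (`cutsOff_iff`, `exists_isRankSeq`). A label that is not
a valley gives the empty interval, since there the path goes on with an east step and the rank
drops. Dyck paths correspond to sequences `r 0, …, r b` of this kind (`IsRankSeq`), which turns
membership in `NC a b` into a statement about such sequences (`mem_NC_iff`).

*The invariant condition.* Call an interval `(x, y]` with `0 ≤ x ≤ y ≤ b - 1` saturated for `π` if it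
is a union of blocks, and let `weight g` be the residue of `-a g` modulo `b`. Then `π` is in
`NC a b` if and only if (`IsBalanced`)

* two labels not separated by a saturated interval are in the same block, that is, `π` is
  noncrossing, and
* whenever the circle of the labels `1, …, b - 1` is cut into three saturated arcs, the weights of
  the lengths of the arcs add up to `a`.

The complement of a saturated arc is saturated, so both conditions are preserved by the dihedral
group (`IsBalanced.permute_rot`, `IsBalanced.permute_rfn`).

*Lasers give a balanced partition.* Lasers are saturated, which is the first condition. For the
second, `r x ≤ r y ≤ r x + a` for every saturated `(x, y]` (`IsRankSeq.le_of_saturated`): otherwise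
some label inside the interval is cut off by the same lasers as a label outside. As the rank
differences lie between `0` and `a < b`, they are equal to the weights of the three arcs.

*A balanced partition comes from lasers.* Let `(p, q p]` be the largest saturated interval starting
at `p` (`reach`). If this is to be the laser of `p`, the ranks have to satisfy
`r p = r (q p + 1) + weight (p + (b - 1) - q p)`, which determines them (`rank`). The condition on
weights says that the interval `(p, q p]` is indeed the laser of `p` (`IsBalanced.rank_lt`), and the
condition on separation that these intervals cut out `π` (`mem_NC_iff_isBalanced`).
-/

namespace RationalNC

variable {a b : ℕ} {D : List Step}

/-! ### Ranks of lattice points and the geometry of lasers -/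

/-- The rank `b y - a x` of the lattice point `(x, y)` reached after `k` steps of the path. It is
nonnegative on a Dyck path, and lines of slope `a / b` are its level sets. -/
def pointRank (a b : ℕ) (D : List Step) (k : ℕ) : ℤ := (b : ℤ) * yAt D k - (a : ℤ) * xAt D k

theorem xAt_succ_east {k : ℕ} (h : D[k]? = some Step.E) : xAt D (k + 1) = xAt D k + 1 := by
  simp [xAt, List.take_add_one, h]

theorem yAt_succ_east {k : ℕ} (h : D[k]? = some Step.E) : yAt D (k + 1) = yAt D k := by
  simp [yAt, List.take_add_one, h]

theorem xAt_succ_north {k : ℕ} (h : D[k]? = some Step.N) : xAt D (k + 1) = xAt D k := by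
  simp [xAt, List.take_add_one, h]

theorem yAt_succ_north {k : ℕ} (h : D[k]? = some Step.N) : yAt D (k + 1) = yAt D k + 1 := by
  simp [yAt, List.take_add_one, h]

theorem xAt_mono (D : List Step) : Monotone (xAt D) := fun _ _ h =>
  (List.take_sublist_take_left h).count_le _

theorem yAt_mono (D : List Step) : Monotone (yAt D) := fun _ _ h =>
  (List.take_sublist_take_left h).count_le _

theorem pointRank_succ_east {k : ℕ} (h : D[k]? = some Step.E) :
    pointRank a b D (k + 1) = pointRank a b D k - a := by
  simp only [pointRank, xAt_succ_east h, yAt_succ_east h]; push_cast; ring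

theorem pointRank_succ_north {k : ℕ} (h : D[k]? = some Step.N) :
    pointRank a b D (k + 1) = pointRank a b D k + b := by
  simp only [pointRank, xAt_succ_north h, yAt_succ_north h]; push_cast; ring

theorem step_cases {k : ℕ} (h : k < D.length) : D[k]? = some Step.E ∨ D[k]? = some Step.N := by
  rw [List.getElem?_eq_getElem h]
  cases D[k] <;> simp

theorem lt_length_of_getElem? {k : ℕ} {s : Step} (h : D[k]? = some s) : k < D.length :=
  (List.getElem?_eq_some_iff.1 h).1

/-- Along the ray the rank is constant, so a point of the ray on the path is a point of a step at
which the rank interpolates the value at the start of the ray. -/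
theorem rayPoint_mem_trace (hb : 0 < b) {k : ℕ} {s : ℝ} (h : rayPoint a b D k s ∈ trace D) :
    ∃ l < D.length, ∃ α β : ℝ, 0 ≤ α ∧ 0 ≤ β ∧ α + β = 1 ∧
      (xAt D k : ℝ) + s = α * xAt D l + β * xAt D (l + 1) ∧
      (pointRank a b D k : ℝ) = α * pointRank a b D l + β * pointRank a b D (l + 1) := by
  obtain ⟨l, hl, α, β, hα, hβ, hαβ, h⟩ := h
  refine ⟨l, hl, α, β, hα, hβ, hαβ, ?_, ?_⟩
  · simpa [rayPoint, latticePoint] using (congrArg Prod.fst h).symm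
  · have h1 := congrArg Prod.fst h
    have h2 := congrArg Prod.snd h
    simp only [rayPoint, latticePoint, Prod.smul_mk, Prod.mk_add_mk, smul_eq_mul] at h1 h2
    have hb' : (b : ℝ) ≠ 0 := by positivity
    field_simp at h2
    simp only [pointRank]
    push_cast
    linear_combination (a : ℝ) * h1 - h2

theorem LaserExtent.unique {k : ℕ} {t t' : ℝ} (h : LaserExtent a b D k t)
    (h' : LaserExtent a b D k t') : t = t' := by
  rcases lt_trichotomy t t' with hlt | heq | hlt
  · exact absurd h.2.1 (h'.2.2 t h.1 hlt)
  · exact heq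
  · exact absurd h'.2.1 (h.2.2 t' h'.1 hlt)

/-- The laser from the lattice point after `k` steps ends on the east step `m` which first brings
the rank down to its value at the start. -/
theorem laserExtent_of_first_descent (ha : 0 < a) (hb : 0 < b) {k m : ℕ} (hkm : k < m)
    (hm : D[m]? = some Step.E)
    (habove : ∀ l, k < l → l ≤ m → pointRank a b D k < pointRank a b D l)
    (hbelow : pointRank a b D (m + 1) ≤ pointRank a b D k) :
    LaserExtent a b D k
      ((xAt D m : ℝ) - xAt D k + ((pointRank a b D m : ℝ) - pointRank a b D k) / a) := by
  have ha' : (0 : ℝ) < a := by exact_mod_cast ha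
  have hb' : (0 : ℝ) < b := by exact_mod_cast hb
  set u : ℝ := ((pointRank a b D m : ℝ) - pointRank a b D k) / a with hu
  have hau : (a : ℝ) * u = (pointRank a b D m : ℝ) - pointRank a b D k := by
    rw [hu]; field_simp
  have h1 : (pointRank a b D k : ℝ) < pointRank a b D m := by
    exact_mod_cast habove m hkm le_rfl
  have hu0 : 0 < u := by rw [hu]; exact div_pos (by linarith) ha'
  have hu1 : u ≤ 1 := by
    rw [pointRank_succ_east hm] at hbelow
    have : (pointRank a b D m : ℝ) - a ≤ pointRank a b D k := by exact_mod_cast hbelow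
    rw [hu, div_le_one ha']; linarith
  have hx : (xAt D k : ℝ) ≤ xAt D m := by exact_mod_cast xAt_mono D hkm.le
  refine ⟨by linarith, ⟨m, lt_length_of_getElem? hm, 1 - u, u, by linarith, hu0.le, by ring, ?_⟩, ?_⟩
  · simp only [rayPoint, latticePoint, xAt_succ_east hm, yAt_succ_east hm, Prod.smul_mk,
      Prod.mk_add_mk, smul_eq_mul, Prod.mk.injEq]
    refine ⟨by push_cast; ring, ?_⟩
    simp only [pointRank] at hau
    push_cast at hau
    field_simp
    linear_combination -hau
  · intro s hs0 hs hmem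
    obtain ⟨l, hl, α, β, hα, hβ, hαβ, h2, h3⟩ := rayPoint_mem_trace hb hmem
    have hα' : α = 1 - β := by linarith
    subst hα'
    have hmono : (xAt D l : ℝ) ≤ xAt D (l + 1) := by exact_mod_cast xAt_mono D (Nat.le_succ l)
    rcases lt_or_ge l k with hlk | hlk
    · have : (xAt D (l + 1) : ℝ) ≤ xAt D k := by exact_mod_cast xAt_mono D hlk
      nlinarith
    rcases lt_trichotomy l m with hlm | rfl | hlm
    · have h4 : (pointRank a b D k : ℝ) < pointRank a b D (l + 1) := by
        exact_mod_cast habove (l + 1) (by omega) (by omega)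
      have h5 : (pointRank a b D k : ℝ) ≤ pointRank a b D l := by
        rcases hlk.eq_or_lt with rfl | hlk
        · exact le_rfl
        · exact_mod_cast (habove l hlk hlm.le).le
      have hβ0 : β = 0 := by nlinarith
      subst hβ0
      rcases hlk.eq_or_lt with rfl | hlk
      · linarith
      · have : (pointRank a b D k : ℝ) < pointRank a b D l := by
          exact_mod_cast habove l hlk hlm.le
        linarith
    · rw [xAt_succ_east hm] at h2
      rw [pointRank_succ_east hm] at h3
      push_cast at h2 h3
      have : (a : ℝ) * (β - u) = 0 := by linear_combination h3 - hau
      have : β = u := by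
        rcases mul_eq_zero.1 this with h | h
        · exact absurd h ha'.ne'
        · linarith
      subst this
      linarith
    · have : (xAt D (m + 1) : ℝ) ≤ xAt D l := by exact_mod_cast xAt_mono D hlm
      rw [xAt_succ_east hm] at this
      push_cast at this
      nlinarith

/-- A laser ends on an east step: the first step which brings the rank back to or below its value
at the start of the laser cannot be a north step, as these raise the rank. -/
theorem exists_first_descent {k : ℕ} (hk : D[k]? = some Step.N) (hb : 0 < b)
    (hlast : pointRank a b D D.length ≤ pointRank a b D k) :
    ∃ m, k < m ∧ D[m]? = some Step.E ∧
      (∀ l, k < l → l ≤ m → pointRank a b D k < pointRank a b D l) ∧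
      pointRank a b D (m + 1) ≤ pointRank a b D k := by
  classical
  have hex : ∃ m, k < m ∧ m < D.length + 1 ∧ pointRank a b D m ≤ pointRank a b D k :=
    ⟨D.length, lt_length_of_getElem? hk, by omega, hlast⟩
  obtain ⟨h1, h2, h3⟩ := Nat.find_spec hex
  have hmin : ∀ l, k < l → l < Nat.find hex → pointRank a b D k < pointRank a b D l := by
    intro l hl hlt
    have := Nat.find_min hex hlt
    by_contra hc
    exact this ⟨hl, by omega, not_lt.1 hc⟩
  obtain ⟨m, hm⟩ : ∃ m, Nat.find hex = m + 1 := ⟨Nat.find hex - 1, by omega⟩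
  rw [hm] at h1 h2 h3 hmin
  have hkm : k < m := by
    rcases (Nat.lt_succ_iff.1 h1).eq_or_lt with rfl | h
    · rw [pointRank_succ_north hk] at h3
      omega
    · exact h
  refine ⟨m, hkm, ?_, fun l hl hlm => hmin l hl (by omega), h3⟩
  rcases step_cases (D := D) (k := m) (by omega) with h | h
  · exact h
  · rw [pointRank_succ_north h] at h3
    have := hmin m hkm (by omega)
    omega

/-- The laser from a lattice point followed by a north step cuts off the labels of those later east
steps up to which the rank has stayed above its value at the start. -/
theorem cutsOff_iff (ha : 0 < a) (hb : 0 < b) {k i : ℕ} (hk : D[k]? = some Step.N)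
    (hlast : pointRank a b D D.length ≤ pointRank a b D k) :
    CutsOff a b D k i ↔ ∃ m, D[m]? = some Step.E ∧ xAt D (m + 1) = i ∧ k < m + 1 ∧
      ∀ l, k < l → l ≤ m + 1 → pointRank a b D k < pointRank a b D l := by
  have ha' : (0 : ℝ) < a := by exact_mod_cast ha
  have hb' : (0 : ℝ) < b := by exact_mod_cast hb
  obtain ⟨d, hkd, hd, habove, hbelow⟩ := exists_first_descent hk hb hlast
  have hext := laserExtent_of_first_descent ha hb hkd hd habove hbelow
  have hrank : ∀ m, xAt D (m + 1) = i → ((yAt D k : ℝ) + (a : ℝ) / (b : ℝ) * ((i : ℝ) - xAt D k) <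
      (yAt D (m + 1) : ℝ) ↔ pointRank a b D k < pointRank a b D (m + 1)) := by
    rintro m rfl
    rw [← Int.cast_lt (R := ℝ)]
    simp only [pointRank]
    push_cast
    rw [← mul_lt_mul_iff_right₀ hb']
    have : (b : ℝ) * (yAt D k + a / b * ((xAt D (m + 1) : ℝ) - xAt D k)) =
      b * yAt D k + a * ((xAt D (m + 1) : ℝ) - xAt D k) := by field_simp
    rw [this]
    constructor <;> intro h <;> linarith
  have hdr : (0 : ℝ) < (pointRank a b D d : ℝ) - pointRank a b D k := by
    have : (pointRank a b D k : ℝ) < pointRank a b D d := by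
      exact_mod_cast habove d hkd le_rfl
    linarith
  have hdr' : ((pointRank a b D d : ℝ) - pointRank a b D k) / a ≤ 1 := by
    rw [pointRank_succ_east hd] at hbelow
    have : (pointRank a b D d : ℝ) - a ≤ pointRank a b D k := by exact_mod_cast hbelow
    rw [div_le_one ha']; linarith
  constructor
  · rintro ⟨t, h, ht, ⟨m, hm, hmi, rfl⟩, h1, h2, h3⟩
    rw [hrank m hmi] at h3
    rw [ht.unique hext, ← hmi] at h2
    refine ⟨m, hm, hmi, ?_, ?_⟩
    · by_contra hc
      have hx := xAt_mono D (not_lt.1 hc)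
      have hy := yAt_mono D (not_lt.1 hc)
      have hx' : xAt D k ≤ i := by exact_mod_cast h1
      have hxe : xAt D (m + 1) = xAt D k := by omega
      simp only [pointRank, hxe] at h3
      have : (b : ℤ) * yAt D (m + 1) ≤ b * yAt D k := by gcongr
      omega
    · have hmd : m < d := by
        by_contra hc
        rcases (not_lt.1 hc).eq_or_lt with rfl | hc
        · omega
        · have hx := xAt_mono D (Nat.succ_le_of_lt hc)
          rw [xAt_succ_east hm] at h2
          rw [Nat.succ_eq_add_one, xAt_succ_east hd] at hx
          have : (xAt D d : ℝ) + 1 ≤ xAt D m := by exact_mod_cast hx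
          push_cast at h2
          linarith
      exact fun l hl hlm => habove l hl (by omega)
  · rintro ⟨m, hm, hmi, hkm, hall⟩
    refine ⟨_, yAt D (m + 1), hext, ⟨m, hm, hmi, rfl⟩, ?_, ?_, (hrank m hmi).2 (hall _ hkm le_rfl)⟩
    · rw [← hmi]; exact_mod_cast xAt_mono D hkm.le
    · have hmd : m + 1 ≤ d := by
        by_contra hc
        have := hall (d + 1) (by omega) (by omega)
        omega
      have : (xAt D (m + 1) : ℝ) ≤ xAt D d := by exact_mod_cast xAt_mono D hmd
      have := div_pos hdr ha'
      rw [← hmi]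
      linarith

/-! ### Rank sequences of Dyck paths -/

/-- The sequences of ranks `r i` of the label points of an `a,b`-Dyck path, extended by `r 0 = 0` for
the origin: each east step lowers the rank by `a`, after north steps that have raised it. The value
`h` in `congr` is the height of the label point. -/
structure IsRankSeq (a b : ℕ) (r : ℕ → ℤ) : Prop where
  zero : r 0 = 0
  last : r b = 0
  pos : ∀ i, 0 < i → i < b → 0 < r i
  step : ∀ i < b, r i - a ≤ r (i + 1)
  congr : ∀ i ≤ b, ∃ h : ℤ, r i = b * h - a * i

/-- In terms of a rank sequence, the laser fired from the label `p` cuts off the label `i`. -/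
def Under (r : ℕ → ℤ) (p i : ℕ) : Prop := p < i ∧ ∀ j, p < j → j ≤ i → r p < r j

/-- Coprimality enters through the fact that points with abscissa strictly between `0` and `b` do
not have rank `0`. -/
theorem pos_of_congr (hcop : Nat.Coprime a b) {i : ℕ} (hi : 0 < i) (hib : i < b) {z h : ℤ}
    (hz : 0 ≤ z) (hzh : z = b * h - a * i) : 0 < z := by
  refine hz.lt_of_ne fun h0 => ?_
  have h1 : (b : ℤ) ∣ a * i := ⟨h, by linarith⟩
  have h2 : b ∣ a * i := by exact_mod_cast h1
  exact absurd (Nat.le_of_dvd hi (hcop.symm.dvd_of_dvd_mul_left h2)) (not_le.2 hib)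

theorem east_unique {m m' : ℕ} (hm : D[m]? = some Step.E) (hm' : D[m']? = some Step.E)
    (h : xAt D (m + 1) = xAt D (m' + 1)) : m = m' := by
  rw [xAt_succ_east hm, xAt_succ_east hm'] at h
  rcases lt_trichotomy m m' with hlt | heq | hlt
  · have := xAt_mono D (Nat.succ_le_of_lt hlt)
    rw [Nat.succ_eq_add_one, xAt_succ_east hm] at this
    omega
  · exact heq
  · have := xAt_mono D (Nat.succ_le_of_lt hlt)
    rw [Nat.succ_eq_add_one, xAt_succ_east hm'] at this
    omega

theorem exists_east {i : ℕ} (hi : 0 < i) (hib : i ≤ D.count Step.E) :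
    ∃ m, D[m]? = some Step.E ∧ xAt D (m + 1) = i := by
  classical
  have hex : ∃ m, i ≤ xAt D m := ⟨D.length, by simpa [xAt] using hib⟩
  have hspec := Nat.find_spec hex
  have hpos : Nat.find hex ≠ 0 := by
    intro h
    rw [h] at hspec
    simp [xAt] at hspec
    omega
  obtain ⟨m, hm⟩ := Nat.exists_eq_succ_of_ne_zero hpos
  have hmin : xAt D m < i := not_le.1 (Nat.find_min hex (by omega))
  rw [hm, Nat.succ_eq_add_one] at hspec
  have hlen : m < D.length := by
    by_contra hc
    have h1 : xAt D (m + 1) = xAt D m := by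
      simp only [xAt]
      rw [List.take_of_length_le (by omega), List.take_of_length_le (by omega)]
    omega
  rcases step_cases hlen with h | h
  · exact ⟨m, h, by have := xAt_succ_east h; omega⟩
  · have := xAt_succ_north h; omega

/-- Every path has a function `T` such that its `i`-th east step ends after `T i` steps. -/
theorem exists_labelTime (D : List Step) :
    ∃ T : ℕ → ℕ, T 0 = 0 ∧ (∀ i, 0 < i → i ≤ D.count Step.E →
      ∃ m, T i = m + 1 ∧ D[m]? = some Step.E ∧ xAt D (m + 1) = i) := by
  have h : ∀ i, ∃ t, (i = 0 → t = 0) ∧ (0 < i → i ≤ D.count Step.E →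
      ∃ m, t = m + 1 ∧ D[m]? = some Step.E ∧ xAt D (m + 1) = i) := by
    intro i
    by_cases hi : 0 < i ∧ i ≤ D.count Step.E
    · obtain ⟨m, h1, h2⟩ := exists_east hi.1 hi.2
      exact ⟨m + 1, by omega, fun _ _ => ⟨m, rfl, h1, h2⟩⟩
    · exact ⟨0, fun _ => rfl, fun h h' => absurd ⟨h, h'⟩ hi⟩
  choose T hT using h
  exact ⟨T, (hT 0).1 rfl, fun i => (hT i).2⟩

theorem IsDyckPath.pointRank_nonneg (hD : IsDyckPath a b D) {k : ℕ} (hk : k ≤ D.length) :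
    0 ≤ pointRank a b D k := by
  have : (a : ℤ) * xAt D k ≤ b * yAt D k := by exact_mod_cast hD.above k hk
  simp only [pointRank]; omega

theorem IsDyckPath.pointRank_length (hD : IsDyckPath a b D) : pointRank a b D D.length = 0 := by
  simp only [pointRank, xAt, yAt, List.take_length, hD.count_north, hD.count_east]
  ring

/-- Between two label points there are only north steps, which raise the rank. Hence the rank stays
above the value at the start iff it does so at label points. -/
theorem forall_lt_pointRank_iff (hb : 0 < b) {T : ℕ → ℕ} (hT : ∀ i, 0 < i → i ≤ D.count Step.E →
      ∃ m, T i = m + 1 ∧ D[m]? = some Step.E ∧ xAt D (m + 1) = i) {p i : ℕ}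
    (hxp : xAt D (T p) = p)
    (hpi : p < i) (hi : i ≤ D.count Step.E) :
    (∀ l, T p < l → l ≤ T i → pointRank a b D (T p) < pointRank a b D l) ↔
      ∀ j, p < j → j ≤ i → pointRank a b D (T p) < pointRank a b D (T j) := by
  have hx : ∀ j, 0 < j → j ≤ D.count Step.E → xAt D (T j) = j := by
    intro j h1 h2
    obtain ⟨m, h3, _, h5⟩ := hT j h1 h2
    rw [h3, h5]
  have hlt : ∀ j j', xAt D (T j) = j → xAt D (T j') = j' → j < j' → T j < T j' := by
    intro j j' h1 h2 h3
    by_contra hc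
    have := xAt_mono D (not_lt.1 hc)
    omega
  constructor
  · intro h j hpj hji
    refine h _ (hlt _ _ hxp (hx j (by omega) (by omega)) hpj) ?_
    rcases hji.eq_or_lt with rfl | hji
    · exact le_rfl
    · exact (hlt _ _ (hx j (by omega) (by omega)) (hx i (by omega) hi) hji).le
  · intro h l hl
    induction l with
    | zero => omega
    | succ l ih =>
      intro hli
      have hle : pointRank a b D (T p) ≤ pointRank a b D l := by
        rcases (Nat.lt_succ_iff.1 hl).eq_or_lt with h1 | h1
        · rw [h1]
        · exact (ih h1 (by omega)).le
      have hlen : l < D.length := by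
        obtain ⟨m, h1, h2, _⟩ := hT i (by omega) hi
        have := lt_length_of_getElem? h2
        omega
      rcases step_cases hlen with h1 | h1
      · have hpl := xAt_mono D (Nat.lt_succ_iff.1 hl)
        have hll := xAt_mono D hli
        rw [hx i (by omega) hi] at hll
        rw [hxp] at hpl
        have hs := xAt_succ_east h1
        obtain ⟨m, h2, h3, h4⟩ := hT (xAt D (l + 1)) (by omega) (by omega)
        have := h (xAt D (l + 1)) (by omega) hll
        rwa [h2, east_unique h3 h1 h4] at this
      · rw [pointRank_succ_north h1]
        omega

/-- The ranks of the labels of a Dyck path form a rank sequence that determines the partition. -/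
theorem exists_isRankSeq (ha : 0 < a) (hab : a < b) (hcop : Nat.Coprime a b)
    (hD : IsDyckPath a b D) :
    ∃ r, IsRankSeq a b r ∧ (∀ i h, 0 < i → i < b → IsLabel D i h → r i = b * h - a * i) ∧
      ∀ i j : Fin (b - 1), visibility a b D i j ↔
        ∀ p, 0 < p → p < b → (Under r p (i + 1) ↔ Under r p (j + 1)) := by
  have hb : 0 < b := by omega
  obtain ⟨T, hT0, hT⟩ := exists_labelTime D
  have hx : ∀ j ≤ b, xAt D (T j) = j := by
    intro j h2
    rcases Nat.eq_zero_or_pos j with rfl | h1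
    · simp [hT0, xAt]
    · obtain ⟨m, h3, _, h5⟩ := hT j h1 (by rw [hD.count_east]; exact h2)
      rw [h3, h5]
  have hlt : ∀ j ≤ b, ∀ j' ≤ b, j < j' → T j < T j' := by
    intro j hj j' hj' h3
    by_contra hc
    have := xAt_mono D (not_lt.1 hc)
    rw [hx j hj, hx j' hj'] at this
    omega
  have hlen : ∀ j ≤ b, T j ≤ D.length := by
    intro j hj
    rcases Nat.eq_zero_or_pos j with rfl | h1
    · simp [hT0]
    · obtain ⟨m, h3, h4, _⟩ := hT j h1 (by rw [hD.count_east]; exact hj)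
      have := lt_length_of_getElem? h4
      omega
  have hcongr : ∀ j ≤ b, pointRank a b D (T j) = b * (yAt D (T j) : ℤ) - a * j := by
    intro j hj
    simp [pointRank, hx j hj]
  have hpos : ∀ i, 0 < i → i < b → 0 < pointRank a b D (T i) := fun i hi hib =>
    pos_of_congr hcop hi hib (hD.pointRank_nonneg (hlen i hib.le)) (hcongr i hib.le)
  refine ⟨fun i => pointRank a b D (T i), ⟨?_, ?_, hpos, ?_, fun j hj => ⟨_, hcongr j hj⟩⟩, ?_, ?_⟩
  · simp [hT0, pointRank, xAt, yAt]
  · refine le_antisymm ?_ (hD.pointRank_nonneg (hlen b le_rfl))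
    have h1 : yAt D (T b) ≤ a := by
      rw [← hD.count_north]
      exact (List.take_sublist _ _).count_le _
    have h2 : (b : ℤ) * yAt D (T b) ≤ b * a := by gcongr
    rw [hcongr b le_rfl]
    linarith [mul_comm (a : ℤ) b]
  · intro i hi
    rw [hcongr i hi.le, hcongr (i + 1) hi]
    have h1 := yAt_mono D (hlt i hi.le (i + 1) hi (Nat.lt_succ_self i)).le
    have h2 : (b : ℤ) * yAt D (T i) ≤ b * yAt D (T (i + 1)) := by gcongr
    push_cast
    linarith
  · rintro i h hi hib ⟨m, h1, h2, rfl⟩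
    obtain ⟨m', h3, h4, h5⟩ := hT i hi (by rw [hD.count_east]; exact hib.le)
    simp only [h3, east_unique h4 h1 (h5.trans h2.symm), pointRank, h2]
  · have key : ∀ p, 0 < p → p < b → D[T p]? = some Step.N → ∀ i, 0 < i → i < b →
        (CutsOff a b D (T p) i ↔ Under (fun i => pointRank a b D (T i)) p i) := by
      intro p hp hpb hN i hi hib
      rw [cutsOff_iff ha hb hN (by rw [hD.pointRank_length]; exact (hpos p hp hpb).le)]
      obtain ⟨m, h1, h2, h3⟩ := hT i hi (by rw [hD.count_east]; exact hib.le)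
      constructor
      · rintro ⟨m', h4, h5, h6, h7⟩
        obtain rfl := east_unique h2 h4 (h3.trans h5.symm)
        have hpi : p < i := by
          by_contra hc
          rcases (not_lt.1 hc).eq_or_lt with rfl | hc
          · omega
          · have := hlt i hib.le p hpb.le hc
            omega
        refine ⟨hpi, (forall_lt_pointRank_iff hb hT (hx p hpb.le) hpi ?_).1 ?_⟩
        · rw [hD.count_east]; exact hib.le
        · rwa [h1]
      · rintro ⟨hpi, h4⟩
        have := (forall_lt_pointRank_iff hb hT (hx p hpb.le) hpi
          (by rw [hD.count_east]; exact hib.le)).2 h4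
        rw [h1] at this
        exact ⟨m, h2, h3, h1 ▸ hlt p hpb.le i hib.le hpi, this⟩
    intro i j
    constructor
    · intro h p hp hpb
      have hplen : T p < D.length :=
        (hlt p hpb.le b le_rfl hpb).trans_le (hlen b le_rfl)
      rcases step_cases hplen with hE | hN
      · -- an east step after `p` lowers the rank, so `p` cuts off nothing
        have hempty : ∀ i, ¬ Under (fun i => pointRank a b D (T i)) p i := by
          rintro i ⟨hpi, h1⟩
          have h2 := h1 (p + 1) (by omega) hpi
          obtain ⟨m, h3, h4, h5⟩ := hT (p + 1) (by omega) (by rw [hD.count_east]; exact hpb)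
          have h6 : m = T p := east_unique h4 hE (by rw [h5, xAt_succ_east hE, hx p hpb.le])
          subst h6
          simp only [h3, pointRank_succ_east hE] at h2
          omega
        simp only [hempty]
      · rw [← key p hp hpb hN _ (by omega) (by omega), ← key p hp hpb hN _ (by omega) (by omega)]
        obtain ⟨m, h1, h2, _⟩ := hT p hp (by rw [hD.count_east]; exact hpb.le)
        exact h (T p) ⟨by omega, by rw [h1]; exact h2, hN⟩
    · rintro h k ⟨hk, hE, hN⟩
      obtain ⟨l, rfl⟩ : ∃ l, k = l + 1 := ⟨k - 1, by omega⟩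
      rw [Nat.add_sub_cancel] at hE
      have hklen := lt_length_of_getElem? hN
      have hxk : xAt D (l + 1) ≤ b := by
        rw [← hD.count_east]
        exact (List.take_sublist _ _).count_le _
      have hs := xAt_succ_east hE
      obtain ⟨m, h1, h2, h3⟩ := hT (xAt D (l + 1)) (by omega) (by rw [hD.count_east]; exact hxk)
      obtain rfl := east_unique h2 hE h3
      have hxb : xAt D (m + 1) < b := by
        -- a valley at abscissa `b` would be followed by a point above height `a`
        refine hxk.lt_of_ne fun heq => ?_
        have h4 := hD.above (m + 1) hklen.le
        have h5 := yAt_succ_north hN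
        have h6 : yAt D (m + 1 + 1) ≤ a := by
          rw [← hD.count_north]
          exact (List.take_sublist _ _).count_le _
        rw [heq, mul_comm a b] at h4
        have := Nat.le_of_mul_le_mul_left h4 hb
        omega
      have := key (xAt D (m + 1)) (by omega) hxb (by rw [h1]; exact hN)
      rw [h1] at this
      rw [this _ (by omega) (by omega), this _ (by omega) (by omega)]
      exact h _ (by omega) hxb

/-! ### Dyck paths with given heights -/

/-- The path of `i` east steps, each of them preceded by the north steps that make the heights of
these east steps `H 1, …, H i`. -/
def pathOfHeights (H : ℕ → ℕ) : ℕ → List Step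
  | 0 => []
  | i + 1 => pathOfHeights H i ++ (List.replicate (H (i + 1) - H i) Step.N ++ [Step.E])

theorem count_pathOfHeights {H : ℕ → ℕ} (h0 : H 0 = 0) {n : ℕ}
    (hmono : ∀ i < n, H i ≤ H (i + 1)) :
    (pathOfHeights H n).count Step.N = H n ∧ (pathOfHeights H n).count Step.E = n := by
  induction n with
  | zero => simp [pathOfHeights, h0]
  | succ n ih =>
    obtain ⟨h1, h2⟩ := ih fun i hi => hmono i (by omega)
    have := hmono n (by omega)
    simp [pathOfHeights, List.count_append, List.count_replicate, h1, h2]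
    omega

theorem isLabel_pathOfHeights {H : ℕ → ℕ} (h0 : H 0 = 0) {n : ℕ}
    (hmono : ∀ i < n, H i ≤ H (i + 1)) {i : ℕ} (hi : 0 < i) (hin : i ≤ n) :
    IsLabel (pathOfHeights H n) i (H i) := by
  induction n with
  | zero => omega
  | succ n ih =>
    rcases hin.eq_or_lt with rfl | hlt
    · obtain ⟨h1, h2⟩ := count_pathOfHeights h0 hmono
      have hlen : (pathOfHeights H (n + 1)).length =
          (pathOfHeights H n).length + (H (n + 1) - H n) + 1 := by
        simp [pathOfHeights, add_assoc]
      refine ⟨(pathOfHeights H n).length + (H (n + 1) - H n), ?_, ?_, ?_⟩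
      · simp [pathOfHeights]
      · rw [xAt, List.take_of_length_le hlen.le, h2]
      · rw [yAt, List.take_of_length_le hlen.le, h1]
    · obtain ⟨m, h1, h2, h3⟩ := ih (fun i hi => hmono i (by omega)) (by omega)
      have hm := lt_length_of_getElem? h1
      refine ⟨m, ?_, ?_, ?_⟩
      · rw [pathOfHeights, List.getElem?_append_left hm, h1]
      · rw [xAt, pathOfHeights, List.take_append_of_le_length hm]; exact h2
      · rw [yAt, pathOfHeights, List.take_append_of_le_length hm]; exact h3

theorem above_pathOfHeights {H : ℕ → ℕ} (h0 : H 0 = 0) {n : ℕ}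
    (hmono : ∀ i < n, H i ≤ H (i + 1)) (habove : ∀ i ≤ n, a * i ≤ b * H i) (k : ℕ) :
    a * xAt (pathOfHeights H n) k ≤ b * yAt (pathOfHeights H n) k := by
  induction n with
  | zero => simp [pathOfHeights, xAt]
  | succ n ih =>
    have ih := ih (fun i hi => hmono i (by omega)) (fun i hi => habove i (by omega))
    obtain ⟨h1, h2⟩ := count_pathOfHeights h0 hmono
    obtain ⟨h3, h4⟩ := count_pathOfHeights (n := n) h0 fun i hi => hmono i (by omega)
    rcases le_or_gt k (pathOfHeights H n).length with hk | hk
    · rw [xAt, yAt, pathOfHeights, List.take_append_of_le_length hk]; exact ih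
    rcases le_or_gt (k - (pathOfHeights H n).length) (H (n + 1) - H n) with hk' | hk'
    · have := habove n (by omega)
      rw [xAt, yAt, pathOfHeights, List.take_append, List.take_of_length_le hk.le,
        List.take_append_of_le_length (by simpa using hk')]
      simp only [List.count_append, List.take_replicate, List.count_replicate, h3, h4]
      simp only [reduceCtorEq, beq_iff_eq, if_true, if_false, add_zero]
      exact this.trans (Nat.mul_le_mul_left _ (Nat.le_add_right _ _))
    · have hlen : (pathOfHeights H (n + 1)).length ≤ k := by
        simp [pathOfHeights]; omega
      rw [xAt, yAt, List.take_of_length_le hlen, h1, h2]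
      exact habove _ le_rfl

theorem mem_NC_iff (ha : 0 < a) (hab : a < b) (hcop : Nat.Coprime a b)
    (π : Setoid (Fin (b - 1))) :
    π ∈ NC a b ↔ ∃ r, IsRankSeq a b r ∧ ∀ i j : Fin (b - 1), π i j ↔
      ∀ p, 0 < p → p < b → (Under r p (i + 1) ↔ Under r p (j + 1)) := by
  have hb : (0 : ℤ) < b := by omega
  constructor
  · rintro ⟨D, hD, rfl⟩
    obtain ⟨r, h1, _, h3⟩ := exists_isRankSeq ha hab hcop hD
    exact ⟨r, h1, h3⟩
  · rintro ⟨r, hr, hπ⟩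
    have hnonneg : ∀ i ≤ b, 0 ≤ r i := by
      intro i hi
      rcases Nat.eq_zero_or_pos i with rfl | h0
      · exact hr.zero.ge
      · rcases hi.eq_or_lt with rfl | h1
        · exact hr.last.ge
        · exact (hr.pos i h0 h1).le
    have hH : ∀ i, ∃ h : ℕ, i ≤ b → r i = b * h - a * i := by
      intro i
      by_cases hi : i ≤ b
      · obtain ⟨h, hh⟩ := hr.congr i hi
        have h1 := hnonneg i hi
        have h2 : 0 ≤ h := by
          by_contra hc
          have : (b : ℤ) * h < 0 := mul_neg_of_pos_of_neg hb (not_le.1 hc)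
          have : (0 : ℤ) ≤ a * i := by positivity
          omega
        exact ⟨h.toNat, fun _ => by rw [hh, Int.toNat_of_nonneg h2]⟩
      · exact ⟨0, fun h => absurd h hi⟩
    choose H hH using hH
    have h0 : H 0 = 0 := by
      have h1 := hH 0 (by omega)
      rw [hr.zero] at h1
      have : (b : ℤ) * H 0 = 0 := by simpa using h1.symm
      rcases mul_eq_zero.1 this with h | h <;> omega
    have hHb : H b = a := by
      have h1 := hH b le_rfl
      rw [hr.last] at h1
      have : (b : ℤ) * H b = b * a := by linarith
      exact_mod_cast mul_left_cancel₀ hb.ne' this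
    have hmono : ∀ i < b, H i ≤ H (i + 1) := by
      intro i hi
      have h1 := hr.step i hi
      rw [hH i hi.le, hH (i + 1) hi] at h1
      push_cast at h1
      have : (b : ℤ) * H i ≤ b * H (i + 1) := by linarith
      exact_mod_cast le_of_mul_le_mul_left this hb
    have habove : ∀ i ≤ b, a * i ≤ b * H i := by
      intro i hi
      have h1 := hnonneg i hi
      rw [hH i hi] at h1
      have : (a : ℤ) * i ≤ b * H i := by linarith
      exact_mod_cast this
    have hcount := count_pathOfHeights h0 hmono
    have hD : IsDyckPath a b (pathOfHeights H b) :=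
      ⟨hcount.1.trans hHb, hcount.2, fun k _ => above_pathOfHeights h0 hmono habove k⟩
    refine ⟨_, hD, Setoid.ext fun i j => ?_⟩
    obtain ⟨r', hr', hlab, hvis⟩ := exists_isRankSeq ha hab hcop hD
    have heq : ∀ i < b, r' i = r i := by
      intro i hi
      rcases Nat.eq_zero_or_pos i with rfl | hpos
      · rw [hr.zero, hr'.zero]
      · rw [hlab i _ hpos hi (isLabel_pathOfHeights h0 hmono hpos hi.le), hH i hi.le]
    have hU : ∀ p i, i < b → (Under r' p i ↔ Under r p i) := by
      intro p i hi
      refine and_congr_right fun hpi => forall₃_congr fun j hj hji => ?_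
      rw [heq p (by omega), heq j (by omega)]
    rw [hπ, hvis]
    refine forall₃_congr fun p _ _ => ?_
    rw [hU p _ (by omega), hU p _ (by omega)]

/-! ### Saturated intervals and balanced partitions -/

/-- The interval `(x, y]` of labels is a union of blocks of `π`. The element `i : Fin n` stands for
the label `i + 1`, which is in `(x, y]` iff `x ≤ i < y`. -/
def Saturated {n : ℕ} (π : Setoid (Fin n)) (x y : ℕ) : Prop :=
  ∀ i j : Fin n, π i j → x ≤ i → (i : ℕ) < y → x ≤ j ∧ (j : ℕ) < y

/-- The residue of `-a g` modulo `b`, in `[0, b)`: the rank difference of two label points at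
horizontal distance `g`, provided that this difference is in `[0, b)`. -/
def weight (a b : ℕ) (g : ℤ) : ℤ := (-(a * g)) % b

/-- The dihedrally invariant description of `NC a b`. In `weight_sum`, the circle of labels is cut
into the arcs `(x, y]` and `(y, z]` and their complement, which has `x + (b - 1) - z` elements. -/
structure IsBalanced (a b : ℕ) (π : Setoid (Fin (b - 1))) : Prop where
  separated : ∀ i j : Fin (b - 1), (∀ x y, x ≤ y → y ≤ b - 1 → Saturated π x y →
    (x ≤ i ∧ (i : ℕ) < y ↔ x ≤ j ∧ (j : ℕ) < y)) → π i j
  weight_sum : ∀ x y z : ℕ, x ≤ y → y ≤ z → z ≤ b - 1 → Saturated π x y → Saturated π y z →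
    weight a b (y - x) + weight a b (z - y) + weight a b (x + (b - 1 : ℕ) - z) = a

theorem weight_nonneg (hb : 0 < b) (g : ℤ) : 0 ≤ weight a b g :=
  Int.emod_nonneg _ (by omega)

theorem weight_eq {g z h : ℤ} (h0 : 0 ≤ z) (hz : z < b) (hzh : z = b * h - a * g) :
    weight a b g = z := by
  rw [weight, ← Int.emod_eq_of_lt h0 hz, hzh]
  exact Int.emod_emod_of_dvd _ dvd_rfl |>.symm.trans (by
    rw [show (b : ℤ) * h - a * g = -(a * g) + b * h by ring, Int.add_mul_emod_self_left,
      Int.emod_emod_of_dvd _ dvd_rfl])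

theorem weight_congr (a b : ℕ) (g : ℤ) : ∃ h : ℤ, weight a b g = b * h - a * g :=
  ⟨-(-(a * g) / b), by have := Int.emod_add_mul_ediv (-(a * g)) b; rw [weight]; linarith⟩

theorem weight_pos (hcop : Nat.Coprime a b) {g : ℕ} (hg : 0 < g) (hgb : g < b) :
    0 < weight a b g := by
  obtain ⟨h, hh⟩ := weight_congr a b g
  exact pos_of_congr hcop hg hgb (weight_nonneg (by omega) _) hh

/-! ### Partitions cut out by lasers are balanced -/

/-- If `P` is the last index before `i`, and also before `j`, at which `r` is smaller than there,
then the same lasers cut off `i` and `j`, namely those of `P` and of indices cutting off `P`. -/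
theorem under_iff_under {r : ℕ → ℤ} {P i j : ℕ} (hPi : P < i) (hij : i ≤ j) (hP : r P < r j)
    (hji : r j ≤ r i) (hi : ∀ k, P < k → k < i → r i < r k) (hj : ∀ k, P < k → k < j → r j < r k)
    (p : ℕ) : Under r p i ↔ Under r p j := by
  constructor
  · rintro ⟨hpi, h⟩
    have hpP : p ≤ P := by
      by_contra hc
      have := hi p (by omega) hpi
      have := h i hpi le_rfl
      omega
    have hpP' : r p ≤ r P := by
      rcases hpP.eq_or_lt with rfl | hlt
      · exact le_rfl
      · exact (h P hlt hPi.le).le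
    refine ⟨by omega, fun k hk hkj => ?_⟩
    rcases le_or_gt k P with hkP | hkP
    · exact h k hk (by omega)
    · rcases hkj.eq_or_lt with rfl | hkj
      · omega
      · have := hj k hkP hkj
        omega
  · rintro ⟨hpj, h⟩
    have hpP : p ≤ P := by
      by_contra hc
      have := hj p (by omega) hpj
      have := h j hpj le_rfl
      omega
    exact ⟨by omega, fun k hk hki => h k hk (by omega)⟩

theorem IsRankSeq.ne {r : ℕ → ℤ} (hcop : Nat.Coprime a b) (hr : IsRankSeq a b r) {i j : ℕ}
    (hij : i < j) (hj : j < b) : r i ≠ r j := by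
  intro h
  obtain ⟨u, hu⟩ := hr.congr i (by omega)
  obtain ⟨v, hv⟩ := hr.congr j hj.le
  have := pos_of_congr (z := 0) (h := v - u) hcop (i := j - i) (by omega) (by omega) le_rfl
    (by push_cast [hij.le]; linarith)
  omega

/-- If `r > r j` on `[y, j)`, some label `i ≤ y` is cut off by the same lasers as `j`: take for `P`
the last index before `y` with `r P < r j`, and for `i` the place of the minimum of `r` on
`(P, y]`. -/
theorem IsRankSeq.exists_sibling {r : ℕ → ℤ} (hcop : Nat.Coprime a b) (hr : IsRankSeq a b r)
    {y j : ℕ} (hy : 0 < y) (hyj : y < j) (hj : j < b) (hlt : ∀ k, y ≤ k → k < j → r j < r k) :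
    ∃ i, 0 < i ∧ i ≤ y ∧ (∀ p, Under r p i ↔ Under r p j) ∧ ∀ x < y, r x < r j → x < i := by
  classical
  -- `P` exists because `r 0 = 0 < r j`
  set P := Nat.findGreatest (fun k => r k < r j) (y - 1) with hPdef
  have hP : r P < r j := Nat.findGreatest_spec (P := fun k => r k < r j) (Nat.zero_le _)
    (by rw [hr.zero]; exact hr.pos j (by omega) hj)
  have hPy : P ≤ y - 1 := Nat.findGreatest_le _
  have hgt : ∀ k, P < k → k < j → r j < r k := by
    intro k hk hkj
    rcases le_or_gt y k with h | h
    · exact hlt k h hkj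
    · have := Nat.findGreatest_is_greatest hk (by omega : k ≤ y - 1)
      have := hr.ne hcop hkj hj
      simp only [not_lt] at *
      omega
  obtain ⟨i, hi, hmin⟩ := (Finset.Ioc P y).exists_min_image r ⟨y, by simp; omega⟩
  rw [Finset.mem_Ioc] at hi
  refine ⟨i, by omega, hi.2, under_iff_under hi.1 (by omega) hP (hgt i hi.1 (by omega)).le ?_ hgt, ?_⟩
  · intro k hk hki
    exact lt_of_le_of_ne (hmin k (Finset.mem_Ioc.2 ⟨hk, by omega⟩))
      (hr.ne hcop hki (by omega)).symm
  · intro x hx hxj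
    exact lt_of_le_of_lt (Nat.le_findGreatest (by omega) hxj) hi.1

theorem exists_first_lt {r : ℕ → ℤ} {c : ℤ} {x y : ℕ} (hxy : x ≤ y) (hy : r y < c) (hx : c ≤ r x) :
    ∃ j, x < j ∧ j ≤ y ∧ r j < c ∧ ∀ k, x ≤ k → k < j → c ≤ r k := by
  classical
  have hex : ∃ j, x ≤ j ∧ r j < c := ⟨y, hxy, hy⟩
  obtain ⟨h1, h2⟩ := Nat.find_spec hex
  refine ⟨Nat.find hex, lt_of_le_of_ne h1 fun h => ?_, Nat.find_min' hex ⟨hxy, hy⟩, h2, ?_⟩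
  · rw [← h] at h2; omega
  · intro k hk hkj
    by_contra hc
    exact Nat.find_min hex hkj ⟨hk, not_le.1 hc⟩

/-- If the ranks of `x` and `y` did not satisfy these bounds, `exists_sibling` would relate a label
inside the saturated interval `(x, y]` to one outside: the first drop of the rank below `r x` is
related to a label at most `x`, and the first drop after `y` below `r y`, which is by at most `a`,
to a label in `(x, y]`. -/
theorem IsRankSeq.le_of_saturated {r : ℕ → ℤ} (hcop : Nat.Coprime a b) (hr : IsRankSeq a b r)
    {π : Setoid (Fin (b - 1))} (hπ : ∀ i j : Fin (b - 1), π i j ↔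
      ∀ p, 0 < p → p < b → (Under r p (i + 1) ↔ Under r p (j + 1)))
    {x y : ℕ} (hxy : x ≤ y) (hy : y < b) (hsat : Saturated π x y) :
    r x ≤ r y ∧ r y ≤ r x + a := by
  rcases hxy.eq_or_lt with rfl | hxy
  · constructor <;> omega
  have hrel : ∀ i j, 0 < i → i < b → 0 < j → j < b → (∀ p, Under r p i ↔ Under r p j) →
      (x < i ∧ i ≤ y ↔ x < j ∧ j ≤ y) := by
    intro i j hi hib hj hjb h
    have h1 : π (⟨i - 1, by omega⟩ : Fin (b - 1)) ⟨j - 1, by omega⟩ := by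
      rw [hπ]
      intro p _ _
      simpa only [Nat.sub_add_cancel hi, Nat.sub_add_cancel hj] using h p
    have h2 := hsat _ _ h1
    have h3 := hsat _ _ (π.symm h1)
    simp only at h2 h3
    omega
  constructor
  · by_contra hc
    have hx0 : 0 < x := by
      rcases Nat.eq_zero_or_pos x with rfl | h
      · have := hr.pos y hxy hy
        have := hr.zero
        omega
      · exact h
    obtain ⟨j, h1, h2, h3, h4⟩ := exists_first_lt hxy.le (not_le.1 hc) le_rfl
    obtain ⟨i, h5, h6, h7, -⟩ := hr.exists_sibling hcop hx0 h1 (by omega)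
      (fun k hk hkj => h3.trans_le (h4 k hk hkj))
    have := hrel i j h5 (by omega) (by omega) (by omega) h7
    omega
  · by_contra hc
    have hy0 : r b < r y := by rw [hr.last]; exact hr.pos y (by omega) hy
    obtain ⟨j, h1, h2, h3, h4⟩ := exists_first_lt hy.le hy0 le_rfl
    obtain ⟨l, rfl⟩ : ∃ l, j = l + 1 := ⟨j - 1, by omega⟩
    have hxj : r x < r (l + 1) := by
      have := hr.step l (by omega)
      have := h4 l (by omega) (by omega)
      omega
    have hjb : l + 1 < b := by
      refine h2.lt_of_ne fun h => ?_
      rw [h, hr.last] at hxj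
      rcases Nat.eq_zero_or_pos x with rfl | h0
      · rw [hr.zero] at hxj; omega
      · have := hr.pos x h0 (by omega); omega
    obtain ⟨i, h5, h6, h7, h8⟩ := hr.exists_sibling hcop (by omega) h1 hjb
      (fun k hk hkj => h3.trans_le (h4 k hk hkj))
    have := hrel i _ h5 (by omega) (by omega) hjb h7
    have := h8 x hxy hxj
    omega

theorem IsRankSeq.isBalanced {r : ℕ → ℤ} (hab : a < b) (hcop : Nat.Coprime a b)
    (hr : IsRankSeq a b r) {π : Setoid (Fin (b - 1))} (hπ : ∀ i j : Fin (b - 1), π i j ↔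
      ∀ p, 0 < p → p < b → (Under r p (i + 1) ↔ Under r p (j + 1))) :
    IsBalanced a b π := by
  classical
  constructor
  · intro i j h
    rw [hπ]
    intro p hp hpb
    -- the laser of `p` is the interval `(p, q]`, empty if `q = p`; it is saturated
    set q := Nat.findGreatest (fun q => q = p ∨ Under r p q) (b - 1) with hq
    have hpq : p ≤ q := Nat.le_findGreatest (by omega) (Or.inl rfl)
    have hqb : q ≤ b - 1 := Nat.findGreatest_le _
    have hspec : q = p ∨ Under r p q :=
      Nat.findGreatest_spec (P := fun q => q = p ∨ Under r p q) (m := p) (by omega) (Or.inl rfl)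
    have hU : ∀ i : Fin (b - 1), Under r p (i + 1) ↔ p ≤ i ∧ (i : ℕ) < q := by
      intro i
      constructor
      · intro hi
        have := Nat.le_findGreatest (P := fun q => q = p ∨ Under r p q) (n := b - 1)
          (by omega : (i : ℕ) + 1 ≤ b - 1) (Or.inr hi)
        exact ⟨by have := hi.1; omega, by omega⟩
      · rintro ⟨h1, h2⟩
        rcases hspec with h3 | h3
        · omega
        · exact ⟨by omega, fun k hk hki => h3.2 k hk (by omega)⟩
    rw [hU, hU]
    refine h p q hpq hqb fun i j hij h1 h2 => ?_
    rw [hπ] at hij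
    have := hij p hp hpb
    rw [hU, hU] at this
    exact this.1 ⟨h1, h2⟩
  · intro x y z hxy hyz hz hsxy hsyz
    have hsxz : Saturated π x z := by
      intro i j hij h1 h2
      have h3 := hsxy i j hij
      have h4 := hsyz i j hij
      omega
    rcases Nat.eq_zero_or_pos b with rfl | hb
    · omega
    have h1 := hr.le_of_saturated hcop hπ hxy (by omega) hsxy
    have h2 := hr.le_of_saturated hcop hπ hyz (by omega) hsyz
    have h3 := hr.le_of_saturated hcop hπ (hxy.trans hyz) (by omega) hsxz
    obtain ⟨u, hu⟩ := hr.congr x (by omega)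
    obtain ⟨v, hv⟩ := hr.congr y (by omega)
    obtain ⟨w, hw⟩ := hr.congr z (by omega)
    rw [weight_eq (z := r y - r x) (h := v - u) (by omega) (by omega)
        (by rw [hv, hu]; ring),
      weight_eq (z := r z - r y) (h := w - v) (by omega) (by omega)
        (by rw [hw, hv]; ring),
      weight_eq (z := r x + a - r z) (h := u + a - w) (by omega) (by omega)
        (by rw [hw, hu]; push_cast [hb]; ring)]
    ring

/-! ### The rank sequence of a balanced partition -/

/-- The right end of the largest saturated interval starting at `p`. -/
noncomputable def reach {n : ℕ} (π : Setoid (Fin n)) (p : ℕ) : ℕ := by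
  classical exact Nat.findGreatest (fun q => p ≤ q ∧ Saturated π p q) n

theorem saturated_self {n : ℕ} (π : Setoid (Fin n)) (p : ℕ) : Saturated π p p :=
  fun _ _ _ h1 h2 => by omega

theorem le_reach {n : ℕ} {π : Setoid (Fin n)} {p q : ℕ} (hpq : p ≤ q) (hq : q ≤ n)
    (h : Saturated π p q) : q ≤ reach π p := by
  classical
  exact Nat.le_findGreatest hq ⟨hpq, h⟩

theorem reach_le {n : ℕ} (π : Setoid (Fin n)) (p : ℕ) : reach π p ≤ n := by
  classical
  exact Nat.findGreatest_le _

theorem le_reach_self {n : ℕ} (π : Setoid (Fin n)) {p : ℕ} (hp : p ≤ n) : p ≤ reach π p :=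
  le_reach le_rfl hp (saturated_self π p)

theorem saturated_reach {n : ℕ} (π : Setoid (Fin n)) {p : ℕ} (hp : p ≤ n) :
    Saturated π p (reach π p) := by
  classical
  exact (Nat.findGreatest_spec (P := fun q => p ≤ q ∧ Saturated π p q) hp
    ⟨le_rfl, saturated_self π p⟩).2

/-- The largest saturated intervals are nested: the union of two overlapping ones is saturated. -/
theorem reach_le_reach {n : ℕ} {π : Setoid (Fin n)} {p c : ℕ} (hpc : p ≤ c)
    (hc : c ≤ reach π p) : reach π c ≤ reach π p := by
  by_contra hlt
  have hcn := hc.trans (reach_le π p)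
  have h1 := saturated_reach π hcn
  have h2 := saturated_reach π (hpc.trans hcn)
  refine hlt (le_reach (by omega) (reach_le π c) fun i j hij h3 h4 => ?_)
  have h5 := h1 i j hij
  have h6 := h2 i j hij
  omega

/-- The rank sequence of a balanced partition. The rank at `p` exceeds the rank at the first index
`reach π p + 1` past the laser of `p` by a number in `(0, a]`, which is determined by its residue.
The value is `0` at `0` and from `b` on. -/
noncomputable def rank (a b : ℕ) (π : Setoid (Fin (b - 1))) (p : ℕ) : ℤ :=
  if h : 0 < p ∧ p ≤ b - 1 then
    have := le_reach_self π h.2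
    rank a b π (reach π p + 1) + weight a b (p + (b - 1 : ℕ) - reach π p)
  else 0
termination_by b - p
decreasing_by omega

theorem rank_of_pos {π : Setoid (Fin (b - 1))} {p : ℕ} (hp : 0 < p) (hpb : p ≤ b - 1) :
    rank a b π p =
      rank a b π (reach π p + 1) + weight a b (p + (b - 1 : ℕ) - reach π p) := by
  rw [rank, dif_pos ⟨hp, hpb⟩]

theorem rank_nonneg (hb : 0 < b) (π : Setoid (Fin (b - 1))) (p : ℕ) : 0 ≤ rank a b π p := by
  fun_induction rank a b π p with
  | case1 p h h' ih => exact add_nonneg ih (weight_nonneg hb _)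
  | case2 p h => exact le_rfl

theorem rank_reach_lt (hcop : Nat.Coprime a b) {π : Setoid (Fin (b - 1))} {p : ℕ}
    (hp : 0 < p) (hpb : p ≤ b - 1) : rank a b π (reach π p + 1) < rank a b π p := by
  have h1 := le_reach_self π hpb
  have h2 := reach_le π p
  have h3 : ((p : ℤ) + (b - 1 : ℕ) - reach π p) = ((p + (b - 1) - reach π p : ℕ) : ℤ) := by
    push_cast [show reach π p ≤ p + (b - 1) by omega]; ring
  rw [rank_of_pos hp hpb, h3]
  have := weight_pos hcop (g := p + (b - 1) - reach π p) (by omega) (by omega)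
  omega

theorem rank_congr (π : Setoid (Fin (b - 1))) (p : ℕ) (hpb : p ≤ b) :
    ∃ h : ℤ, rank a b π p = b * h - a * p := by
  fun_induction rank a b π p with
  | case1 p h h' ih =>
    have h2 := reach_le π p
    obtain ⟨u, hu⟩ := ih (by omega)
    obtain ⟨v, hv⟩ := weight_congr a b (p + (b - 1 : ℕ) - reach π p)
    refine ⟨u + v - a, ?_⟩
    rw [hu, hv]
    push_cast [show 1 ≤ b by omega]
    ring
  | case2 p h =>
    rcases Nat.eq_zero_or_pos p with rfl | h0
    · exact ⟨0, by simp⟩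
    · obtain rfl : p = b := by omega
      exact ⟨a, by ring⟩

/-- If the largest saturated intervals starting at `p < c` have the same right end, the complement
of the one from `p` has the smaller weight. This compares the weight sums for `p ≤ c ≤ reach π c` and `c ≤ c ≤ reach π c`. -/
theorem IsBalanced.weight_reach_lt (hcop : Nat.Coprime a b) {π : Setoid (Fin (b - 1))}
    (hπ : IsBalanced a b π) {p c : ℕ} (hpc : p < c) (hcb : c ≤ b - 1)
    (hreach : reach π c = reach π p) :
    weight a b (p + (b - 1 : ℕ) - reach π p) < weight a b (c + (b - 1 : ℕ) - reach π c) := by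
  have h1 := saturated_reach π hcb
  have h2 := saturated_reach π (hpc.le.trans hcb)
  have h3 := le_reach_self π hcb
  have h4 : Saturated π p c := by
    intro i j hij h5 h6
    have h7 := h1 j i (π.symm hij)
    have h8 := h2 i j hij
    omega
  have h5 := hπ.weight_sum p c _ hpc.le h3 (reach_le π c) h4 h1
  have h6 := hπ.weight_sum c c _ le_rfl h3 (reach_le π c) (saturated_self π c) h1
  have h7 : 0 < weight a b ((c : ℤ) - p) := by
    have := weight_pos hcop (g := c - p) (by omega) (by omega)
    rwa [Nat.cast_sub hpc.le] at this
  have h8 : weight a b ((c : ℤ) - c) = 0 := by simp [weight]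
  rw [← hreach]
  omega

/-- Ranks inside the largest saturated interval starting at `p` are greater than that of `p`, by
following `c ↦ reach π c + 1` up to an index whose interval ends where that of `p` does. -/
theorem IsBalanced.rank_lt (hcop : Nat.Coprime a b) {π : Setoid (Fin (b - 1))}
    (hπ : IsBalanced a b π) {p : ℕ} (hp : 0 < p) (c : ℕ) (hpc : p < c) (hc : c ≤ reach π p) :
    rank a b π p < rank a b π c := by
  have hrn := reach_le π p
  have h1 := reach_le_reach hpc.le hc
  have h2 := le_reach_self π (hc.trans hrn)
  rcases h1.eq_or_lt with h3 | h3
  · have := hπ.weight_reach_lt hcop hpc (hc.trans hrn) h3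
    rw [rank_of_pos hp (by omega), rank_of_pos (hp.trans hpc) (hc.trans hrn), h3] at *
    omega
  · have h4 := hπ.rank_lt hcop hp (reach π c + 1) (by omega) (by omega)
    have h5 := rank_reach_lt hcop (π := π) (hp.trans hpc) (hc.trans hrn)
    omega
termination_by b - c

theorem IsBalanced.under_rank_iff (hcop : Nat.Coprime a b) {π : Setoid (Fin (b - 1))}
    (hπ : IsBalanced a b π) {p : ℕ} (hp : 0 < p) (hpb : p ≤ b - 1) (i : Fin (b - 1)) :
    Under (rank a b π) p (i + 1) ↔ p ≤ i ∧ (i : ℕ) < reach π p := by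
  have h0 := le_reach_self π hpb
  constructor
  · rintro ⟨h1, h2⟩
    refine ⟨by omega, ?_⟩
    by_contra hc
    have := h2 (reach π p + 1) (by omega) (by omega)
    have := rank_reach_lt hcop (π := π) hp hpb
    omega
  · rintro ⟨h1, h2⟩
    exact ⟨by omega, fun j hj hji => hπ.rank_lt hcop hp j hj (by omega)⟩

theorem IsBalanced.isRankSeq (hab : a < b) (hcop : Nat.Coprime a b)
    {π : Setoid (Fin (b - 1))} (hπ : IsBalanced a b π) : IsRankSeq a b (rank a b π) := by
  have hb : 0 < b := by omega
  have hzero : rank a b π 0 = 0 := by rw [rank, dif_neg (by omega)]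
  refine ⟨hzero, by rw [rank, dif_neg (by omega)], ?_, ?_, rank_congr π⟩
  · intro i hi hib
    exact (rank_nonneg hb π _).trans_lt (rank_reach_lt hcop hi (by omega))
  · intro i hi
    rcases Nat.eq_zero_or_pos i with rfl | h0
    · have := rank_nonneg (a := a) hb π (0 + 1)
      omega
    rcases (le_reach_self π (p := i) (by omega)).eq_or_lt with h1 | h1
    · have h2 : weight a b (i + (b - 1 : ℕ) - i) = a :=
        weight_eq (h := a) (by omega) (by omega) (by push_cast [hb]; ring)
      rw [rank_of_pos h0 (by omega), ← h1, h2]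
      omega
    · have := hπ.rank_lt hcop h0 (i + 1) (by omega) h1
      omega

theorem mem_NC_iff_isBalanced (ha : 0 < a) (hab : a < b) (hcop : Nat.Coprime a b)
    (π : Setoid (Fin (b - 1))) : π ∈ NC a b ↔ IsBalanced a b π := by
  rw [mem_NC_iff ha hab hcop]
  constructor
  · rintro ⟨r, hr, hπ⟩
    exact hr.isBalanced hab hcop hπ
  · intro hπ
    refine ⟨_, hπ.isRankSeq hab hcop, fun i j => ⟨fun hij p hp hpb => ?_, fun h => ?_⟩⟩
    · rw [hπ.under_rank_iff hcop hp (by omega), hπ.under_rank_iff hcop hp (by omega)]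
      have h1 := saturated_reach π (p := p) (by omega)
      exact ⟨fun h => h1 i j hij h.1 h.2, fun h => h1 j i (π.symm hij) h.1 h.2⟩
    · have hreach : ∀ p, 0 < p → p ≤ b - 1 →
          (p ≤ i ∧ (i : ℕ) < reach π p ↔ p ≤ j ∧ (j : ℕ) < reach π p) := by
        intro p hp hpb
        rw [← hπ.under_rank_iff hcop hp hpb, ← hπ.under_rank_iff hcop hp hpb]
        exact h p hp (by omega)
      refine hπ.separated i j fun x y hxy hy hsat => ?_
      -- `(x, y]` is the difference of `(x, reach x]` and `(y, reach x]`, and `reach y = reach x`;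
      -- for `x = 0` it is the complement of `(y, reach y] = (y, b - 1]`
      rcases Nat.eq_zero_or_pos x with rfl | hx
      · rcases Nat.eq_zero_or_pos y with rfl | hy0
        · omega
        · have h1 : b - 1 ≤ reach π y := by
            refine le_reach hy le_rfl fun i j hij h2 h3 => ?_
            have := hsat j i (π.symm hij)
            omega
          have h2 := hreach y hy0 hy
          omega
      · have h1 := le_reach hxy hy hsat
        have h2 := saturated_reach π (p := x) (by omega)
        have h3 : reach π x ≤ reach π y := by
          refine le_reach h1 (reach_le π x) fun i j hij h4 h5 => ?_
          have h6 := hsat j i (π.symm hij)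
          have h7 := h2 i j hij
          omega
        have h4 := reach_le_reach hxy h1
        have h5 := hreach x hx (by omega)
        rcases Nat.eq_zero_or_pos y with rfl | hy0
        · omega
        have h6 := hreach y hy0 hy
        omega

/-! ### Invariance under the dihedral group -/

theorem IsBalanced.permute_rfn {π : Setoid (Fin (b - 1))} (hπ : IsBalanced a b π) :
    IsBalanced a b (permute (rfn (b - 1)) π) := by
  have hrel : ∀ i j, permute (rfn (b - 1)) π i j ↔ π i.rev j.rev := fun i j => Iff.rfl
  have hsat : ∀ x y, x ≤ y → y ≤ b - 1 → (Saturated (permute (rfn (b - 1)) π) x y ↔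
      Saturated π (b - 1 - y) (b - 1 - x)) := by
    intro x y hxy hy
    constructor
    · intro h i j hij h1 h2
      have := h i.rev j.rev (by rw [hrel, Fin.rev_rev, Fin.rev_rev]; exact hij)
      simp only [Fin.val_rev] at this
      omega
    · intro h i j hij h1 h2
      have := h i.rev j.rev hij
      simp only [Fin.val_rev] at this
      omega
  constructor
  · intro i j h
    rw [hrel]
    refine hπ.separated _ _ fun x y hxy hy hs => ?_
    have := h (b - 1 - y) (b - 1 - x) (by omega) (by omega) (by
      rw [hsat _ _ (by omega) (by omega)]
      convert hs using 1 <;> omega)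
    simp only [Fin.val_rev]
    omega
  · intro x y z hxy hyz hz h1 h2
    rw [hsat x y hxy (by omega)] at h1
    rw [hsat y z hyz hz] at h2
    have := hπ.weight_sum _ _ _ (by omega) (by omega) (by omega) h2 h1
    push_cast [show x ≤ b - 1 by omega, show y ≤ b - 1 by omega, hz] at this ⊢
    rw [← this]
    ring_nf

/-- Cut points `x ≤ y ≤ z` for the rotated partition come from the cut points `x - 1`, `y - 1`,
`z - 1` for `π`, where `-1` means `b - 2` and the order changes cyclically. -/
theorem IsBalanced.permute_rot (ha : 0 < a) (hab : a < b) {π : Setoid (Fin (b - 1))}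
    (hπ : IsBalanced a b π) : IsBalanced a b (permute (rot (b - 1)) π) := by
  obtain ⟨n, rfl⟩ : ∃ n, b = n + 1 + 1 := ⟨b - 2, by omega⟩
  change Setoid (Fin (n + 1)) at π
  change IsBalanced a (n + 1 + 1) (permute (rot (n + 1)) π : Setoid (Fin (n + 1)))
  set π' : Setoid (Fin (n + 1)) := permute (rot (n + 1)) π with hπ'
  have hrel : ∀ i j, π' (rot (n + 1) i) (rot (n + 1) j) ↔ π i j := by
    intro i j
    change π ((rot (n + 1))⁻¹ (rot (n + 1) i)) ((rot (n + 1))⁻¹ (rot (n + 1) j)) ↔ _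
    simp
  have hval : ∀ k : Fin (n + 1), ((k : ℕ) < n ∧ (rot (n + 1) k : ℕ) = k + 1) ∨
      ((k : ℕ) = n ∧ (rot (n + 1) k : ℕ) = 0) := by
    intro k
    have := coe_finRotate k
    rw [rot, this]
    split_ifs with h
    · exact Or.inr ⟨by simp [h], rfl⟩
    · exact Or.inl ⟨Fin.val_lt_last h, rfl⟩
  have hdown : ∀ x y, 1 ≤ x → y ≤ n + 1 → Saturated π' x y → Saturated π (x - 1) (y - 1) := by
    intro x y hx hy h i j hij h1 h2
    have h3 := h _ _ ((hrel i j).2 hij)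
    have h4 := hval i
    have h5 := hval j
    omega
  have hdown' : ∀ y, 1 ≤ y → y ≤ n + 1 → Saturated π' 0 y → Saturated π (y - 1) n := by
    intro y hy hyn h i j hij h1 h2
    have h3 := h _ _ ((hrel j i).2 (π.symm hij))
    have h4 := hval i
    have h5 := hval j
    omega
  constructor
  · intro i j h
    obtain ⟨i, rfl⟩ := (rot (n + 1)).surjective i
    obtain ⟨j, rfl⟩ := (rot (n + 1)).surjective j
    rw [hrel]
    refine hπ.separated i j fun x y hxy hy hs => ?_
    change y ≤ n + 1 at hy
    have h4 := hval i
    have h5 := hval j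
    rcases hy.lt_or_eq with hy | rfl
    · have h6 : Saturated π' (x + 1) (y + 1) := by
        intro i j hij h1 h2
        obtain ⟨i, rfl⟩ := (rot (n + 1)).surjective i
        obtain ⟨j, rfl⟩ := (rot (n + 1)).surjective j
        have h3 := hs i j ((hrel i j).1 hij)
        have h4 := hval i
        have h5 := hval j
        omega
      have h7 := h (x + 1) (y + 1) (by omega) hy h6
      omega
    · rcases hxy.lt_or_eq with hx | rfl
      · -- the complement of `(x, n + 1]` is `(0, x]`, which is rotated to `(1, x + 1]`
        have h6 : Saturated π' 1 (x + 1) := by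
          intro i j hij h1 h2
          obtain ⟨i, rfl⟩ := (rot (n + 1)).surjective i
          obtain ⟨j, rfl⟩ := (rot (n + 1)).surjective j
          have h3 := hs j i (π.symm ((hrel i j).1 hij))
          have h4 := hval i
          have h5 := hval j
          omega
        have h7 := h 1 (x + 1) (by omega) hx h6
        omega
      · omega
  · intro x y z hxy hyz hz h1 h2
    change z ≤ n + 1 at hz
    have hcast : ((n + 1 + 1 - 1 : ℕ) : ℤ) = n + 1 := by push_cast; ring
    rcases Nat.eq_zero_or_pos x with rfl | hx
    · rcases Nat.eq_zero_or_pos z with rfl | hz0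
      · obtain rfl : y = 0 := by omega
        exact hπ.weight_sum 0 0 0 le_rfl le_rfl (by omega) (saturated_self π 0)
          (saturated_self π 0)
      have h3 : Saturated π' 0 z := by
        intro i j hij h3 h4
        have h5 := h1 i j hij
        have h6 := h2 i j hij
        omega
      have h4 := hdown' z hz0 hz h3
      rcases Nat.eq_zero_or_pos y with rfl | hy
      · have := hπ.weight_sum (z - 1) n n (by omega) le_rfl (by omega) h4 (saturated_self π n)
        rw [hcast] at this ⊢
        push_cast [hz0] at this ⊢
        rw [← this]
        ring_nf
      · have := hπ.weight_sum (y - 1) (z - 1) n (by omega) (by omega) (by omega)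
          (hdown y z hy hz h2) h4
        rw [hcast] at this ⊢
        push_cast [hy, hz0] at this ⊢
        rw [← this]
        ring_nf
    · have := hπ.weight_sum (x - 1) (y - 1) (z - 1) (by omega) (by omega) (by omega)
        (hdown x y hx (by omega) h1) (hdown y z (by omega) hz h2)
      rw [hcast] at this ⊢
      push_cast [hx, hx.trans_le hxy, hx.trans_le (hxy.trans hyz)] at this ⊢
      rw [← this]
      ring_nf

theorem permute_mul {n : ℕ} (g h : Equiv.Perm (Fin n)) (π : Setoid (Fin n)) :
    permute (g * h) π = permute g (permute h π) :=
  Setoid.ext fun i j => by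
    change π ((g * h)⁻¹ i) ((g * h)⁻¹ j) ↔ π (h⁻¹ (g⁻¹ i)) (h⁻¹ (g⁻¹ j))
    simp [mul_inv_rev]

/-- In a finite group, the generators generate the subgroup as a monoid, so inverses need no
argument. -/
theorem IsBalanced.permute_of_mem_dihedral (ha : 0 < a) (hab : a < b)
    {g : Equiv.Perm (Fin (b - 1))} (hg : g ∈ dihedral (b - 1)) {π : Setoid (Fin (b - 1))}
    (hπ : IsBalanced a b π) : IsBalanced a b (permute g π) := by
  rw [dihedral, ← Subgroup.mem_toSubmonoid, Subgroup.closure_toSubmonoid_of_finite] at hg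
  induction hg using Submonoid.closure_induction generalizing π with
  | mem g hg =>
    rcases hg with rfl | rfl
    · exact hπ.permute_rot ha hab
    · exact hπ.permute_rfn
  | one => exact hπ
  | mul g h _ _ hg hh => rw [permute_mul]; exact hg (hh hπ)

end RationalNC

theorem mainTheorem2 (a b : ℕ) (ha : 0 < a) (hab : a < b) (hcop : Nat.Coprime a b)
    (g : Equiv.Perm (Fin (b - 1))) (hg : g ∈ RationalNC.dihedral (b - 1))
    (π : Setoid (Fin (b - 1))) (hπ : π ∈ RationalNC.NC a b) :
    RationalNC.permute g π ∈ RationalNC.NC a b := by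
  rw [RationalNC.mem_NC_iff_isBalanced ha hab hcop] at hπ ⊢
  exact hπ.permute_of_mem_dihedral ha hab hg
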